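/- **Proposition 2.3.** Let $n\in\mathbb N$, and write $B>0$ when $B$ is a positive definite complex $n\times n$ matrix. For $\alpha,z>0$ with $\alpha\neq 1$, and for positive semidefinite complex $n\times n$ matrices $A,B$ with $B>0$, put $$P_\alpha(A,B):=B^{1/2}\bigl(B^{-1/2}AB^{-1/2}\bigr)^{\alpha}B^{1/2},\qquad Q_{\alpha,z}(A,B):=\Bigl(B^{\frac{1-\alpha}{2z}}A^{\frac{\alpha}{z}}B^{\frac{1-\alpha}{2z}}\Bigr)^{z}.$$ For positive semidefinite complex $n\times n$ matrices $X,Y$, the log-majorization $X\prec_{\log}Y$ means that $\prod_{i=1}^k\lambda_i(X)\le\prod_{i=1}^k\lambda_i(Y)$ for $k=1,\dots,n$, with equality for $k=n$, where $\lambda_1(X)\ge\dots\ge\lambda_n(X)$ are the eigenvalues of $X$ in decreasing order counting multiplicities. Let $\alpha>1$ and $z>0$. Let $E$ be an (orthogonal) projection in the complex $n\times n$ matrices and let $B>0$ be such that $EB\neq BE$. Then: (a) $P_\alpha(E,B)\prec_{\log}Q_{\alpha,z}(E,B)$ if and only if $z\le\alpha-1$. (b) $Q_{\alpha,z}(E,B)\prec_{\log}P_\alpha(E,B)$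 if and only if $z\ge\alpha-1$. -/

import Mathlib

open scoped MatrixOrder ComplexOrder

/-- `P_α(A, B) = B^{1/2} (B^{-1/2} A B^{-1/2})^α B^{1/2}`. Real powers of matrices are taken by
the (Mathlib) functional calculus `CFC.rpow`. -/
noncomputable def renyiP {n : ℕ} (α : ℝ) (A B : Matrix (Fin n) (Fin n) ℂ) :
    Matrix (Fin n) (Fin n) ℂ :=
  B ^ (1 / 2 : ℝ) * (B ^ (-(1 / 2) : ℝ) * A * B ^ (-(1 / 2) : ℝ)) ^ α * B ^ (1 / 2 : ℝ)

/-- `Q_{α,z}(A, B) = (B^{(1-α)/(2z)} A^{α/z} B^{(1-α)/(2z)})^z`. -/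
noncomputable def renyiQ {n : ℕ} (α z : ℝ) (A B : Matrix (Fin n) (Fin n) ℂ) :
    Matrix (Fin n) (Fin n) ℂ :=
  (B ^ ((1 - α) / (2 * z)) * A ^ (α / z) * B ^ ((1 - α) / (2 * z))) ^ z

/-- Log-majorization `X ≺_log Y`: both matrices are positive semidefinite, and the products of
their `k` largest eigenvalues satisfy `∏_{i ≤ k} λ_i(X) ≤ ∏_{i ≤ k} λ_i(Y)` for all `k ≤ n`,
with equality for `k = n`. Here `eigenvalues₀` lists the eigenvalues in decreasing order with
multiplicity, indexed from `0`. -/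
def LogMajorized {n : ℕ} (X Y : Matrix (Fin n) (Fin n) ℂ) : Prop :=
  ∃ (hX : X.PosSemidef) (hY : Y.PosSemidef),
    (∀ k : ℕ, k ≤ n →
      ∏ i with i.val < k, hX.isHermitian.eigenvalues₀ i ≤
        ∏ i with i.val < k, hY.isHermitian.eigenvalues₀ i) ∧
    ∏ i, hX.isHermitian.eigenvalues₀ i = ∏ i, hY.isHermitian.eigenvalues₀ i

open Matrix

/-! ### Ordered eigenvalues, min-max, functional calculus. -/

section SpectralTools

variable {ι : Type*} [Fintype ι]

/-! Put p = (α-1)/z. For a projection E, P_α(E,B) equals (E B⁻¹ E)^(α-1), and Q_{α,z}(E,B) has the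
eigenvalues of (E B^(-p) E)^z. So both spectra come from compressions of powers of one matrix.

For q ≥ 1, Jensen and min-max give λ_i(ECE)^q ≤ λ_i(E C^q E) for each i
(`IsStarProjection.rpow_eigenvalues₀_le`). With C = B⁻¹, q = p if p ≥ 1, and C = B^(-p), q = 1/p if
p ≤ 1, this compares P and Q eigenvalue by eigenvalue. The full products agree because E is
singular.

If q > 1 and the reverse majorization also held, all eigenvalues would coincide; equality in Jensen
then makes E commute with C, hence with B. This gives both "only if" parts. -/

lemma exists_unit_mulVec_eq_zero (A B : Matrix ι ι ℂ)
    (s t : Finset ι) (hst : s.card + t.card < Fintype.card ι) :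
    ∃ v : ι → ℂ, star v ⬝ᵥ v = 1 ∧ (∀ i ∈ s, (A *ᵥ v) i = 0) ∧ ∀ i ∈ t, (B *ᵥ v) i = 0 := by
  let f : (ι → ℂ) →ₗ[ℂ] (s ⊕ t → ℂ) :=
    LinearMap.pi (Sum.elim (fun i => LinearMap.proj i.1 ∘ₗ A.mulVecLin)
      (fun i => LinearMap.proj i.1 ∘ₗ B.mulVecLin))
  have hf : LinearMap.ker f ≠ ⊥ := f.ker_ne_bot_of_finrank_lt (by simpa using hst)
  obtain ⟨v, hv, hv0⟩ := (Submodule.ne_bot_iff _).1 hf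
  have hA : ∀ i ∈ s, (A *ᵥ v) i = 0 := fun i hi => congrFun hv (Sum.inl ⟨i, hi⟩)
  have hB : ∀ i ∈ t, (B *ᵥ v) i = 0 := fun i hi => congrFun hv (Sum.inr ⟨i, hi⟩)
  have hpos : 0 < star v ⬝ᵥ v := dotProduct_star_self_pos_iff.2 hv0
  obtain ⟨r, hr, hrv⟩ : ∃ r : ℝ, 0 < r ∧ star v ⬝ᵥ v = (r : ℂ) :=
    ⟨(star v ⬝ᵥ v).re, (Complex.pos_iff.1 hpos).1, Complex.ext rfl (Complex.pos_iff.1 hpos).2.symm⟩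
  refine ⟨((Real.sqrt r)⁻¹ : ℂ) • v, ?_, ?_, ?_⟩
  · rw [star_smul, smul_dotProduct, dotProduct_smul, hrv]
    have : (r : ℂ) = (Real.sqrt r : ℂ) * (Real.sqrt r : ℂ) := by
      rw [← Complex.ofReal_mul, Real.mul_self_sqrt hr.le]
    have h0 : (Real.sqrt r : ℂ) ≠ 0 := by
      exact_mod_cast (Real.sqrt_pos.2 hr).ne'
    simp only [smul_eq_mul, star_inv₀, RCLike.star_def, Complex.conj_ofReal]
    rw [this]
    field_simp
  · intro i hi; simp [mulVec_smul, hA i hi]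
  · intro i hi; simp [mulVec_smul, hB i hi]

variable [DecidableEq ι]

/-- The decreasing list of eigenvalues of a Hermitian matrix is the only decreasing enumeration of
the roots of its characteristic polynomial. -/
lemma Matrix.IsHermitian.eigenvalues₀_eq_of_roots_charpoly {N : Matrix ι ι ℂ}
    (hN : N.IsHermitian) {g : Fin (Fintype.card ι) → ℝ} (hg : Antitone g)
    (h : N.charpoly.roots = Multiset.map (fun i => (g i : ℂ)) Finset.univ.val) :
    hN.eigenvalues₀ = g := by
  rw [← List.ofFn_inj, ← hN.sort_roots_charpoly_eq_eigenvalues₀, h]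
  simp_rw [Fin.univ_val_map, Multiset.map_coe, List.map_ofFn, Function.comp_def,
    RCLike.re_eq_complex_re, Complex.ofReal_re, Multiset.coe_sort]
  apply List.mergeSort_of_pairwise
  simp_rw [decide_eq_true_eq, ← List.sortedGE_iff_pairwise]
  exact hg.sortedGE_ofFn

lemma Matrix.IsHermitian.eigenvalues₀_congr {M N : Matrix ι ι ℂ} (hM : M.IsHermitian)
    (hN : N.IsHermitian) (h : M.charpoly = N.charpoly) : hM.eigenvalues₀ = hN.eigenvalues₀ :=
  hM.eigenvalues₀_eq_of_roots_charpoly hN.eigenvalues₀_antitone <| by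
    rw [h, hN.roots_charpoly_eq_eigenvalues₀]; rfl

lemma Matrix.PosSemidef.eigenvalues₀_nonneg {M : Matrix ι ι ℂ} (hM : M.PosSemidef)
    (i : Fin (Fintype.card ι)) : 0 ≤ hM.isHermitian.eigenvalues₀ i := by
  have := hM.eigenvalues_nonneg (Fintype.equivOfCardEq (Fintype.card_fin _) i)
  simpa [Matrix.IsHermitian.eigenvalues] using this

lemma Matrix.posSemidef_rpow (M : Matrix ι ι ℂ) (t : ℝ) : (M ^ t).PosSemidef :=
  (CFC.rpow_nonneg (a := M)).posSemidef

lemma Matrix.PosSemidef.eigenvalues₀_rpow {M : Matrix ι ι ℂ} (hM : M.PosSemidef) {t : ℝ}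
    (ht : 0 ≤ t) (i : Fin (Fintype.card ι)) :
    (M.posSemidef_rpow t).isHermitian.eigenvalues₀ i = hM.isHermitian.eigenvalues₀ i ^ t := by
  have := (M.posSemidef_rpow t).isHermitian.eigenvalues₀_eq_of_roots_charpoly
    (g := fun i => hM.isHermitian.eigenvalues₀ i ^ t)
    (fun i j hij => Real.rpow_le_rpow (hM.eigenvalues₀_nonneg _)
      (hM.isHermitian.eigenvalues₀_antitone hij) ht) ?_
  · rw [this]
  · rw [CFC.rpow_eq_cfc_real hM.nonneg, hM.isHermitian.charpoly_cfc_eq, Polynomial.roots_prod]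
    · simp only [Polynomial.roots_X_sub_C, Multiset.bind_singleton]
      change Multiset.map ((fun x => ((hM.isHermitian.eigenvalues₀ x ^ t : ℝ) : ℂ)) ∘
        (Fintype.equivOfCardEq (Fintype.card_fin _)).symm) _ = _
      rw [← Multiset.map_map]
      congr 1
      simp
    · simp [Finset.prod_ne_zero_iff, Polynomial.X_sub_C_ne_zero]

/-- The quadratic form of `f(M)` in an eigenbasis of `M`. -/
lemma Matrix.IsHermitian.dotProduct_cfc_mulVec {M : Matrix ι ι ℂ} (hM : M.IsHermitian)
    (f : ℝ → ℝ) (v : ι → ℂ) :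
    star v ⬝ᵥ (cfc f M *ᵥ v) = ((∑ i, ‖(star (hM.eigenvectorUnitary : Matrix ι ι ℂ) *ᵥ v) i‖ ^ 2 *
      f (hM.eigenvalues i) : ℝ) : ℂ) := by
  rw [hM.cfc_eq, Matrix.IsHermitian.cfc, Unitary.conjStarAlgAut_apply, ← mulVec_mulVec,
    ← mulVec_mulVec, dotProduct_mulVec]
  have : star v ᵥ* (hM.eigenvectorUnitary : Matrix ι ι ℂ) =
      star (star (hM.eigenvectorUnitary : Matrix ι ι ℂ) *ᵥ v) := by
    rw [star_mulVec, star_eq_conjTranspose, conjTranspose_conjTranspose]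
  rw [this]
  generalize star (hM.eigenvectorUnitary : Matrix ι ι ℂ) *ᵥ v = c
  simp only [dotProduct, mulVec_diagonal, Complex.ofReal_sum]
  refine Finset.sum_congr rfl fun i _ => ?_
  simp only [Pi.star_apply, Function.comp_apply, Complex.ofReal_mul, Complex.ofReal_pow,
    ← Complex.conj_mul']
  simp only [RCLike.star_def, Complex.coe_algebraMap]
  ring

lemma Matrix.IsHermitian.dotProduct_mulVec_self {M : Matrix ι ι ℂ} (hM : M.IsHermitian)
    (v : ι → ℂ) :
    star v ⬝ᵥ (M *ᵥ v) = ((∑ i, ‖(star (hM.eigenvectorUnitary : Matrix ι ι ℂ) *ᵥ v) i‖ ^ 2 *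
      hM.eigenvalues i : ℝ) : ℂ) := by
  have := hM.dotProduct_cfc_mulVec id v
  rwa [cfc_id ℝ M hM.isSelfAdjoint] at this

lemma Matrix.IsHermitian.dotProduct_self {M : Matrix ι ι ℂ} (hM : M.IsHermitian) (v : ι → ℂ) :
    star v ⬝ᵥ v =
      ((∑ i, ‖(star (hM.eigenvectorUnitary : Matrix ι ι ℂ) *ᵥ v) i‖ ^ 2 : ℝ) : ℂ) := by
  have := hM.dotProduct_cfc_mulVec (fun _ => 1) v
  rw [cfc_const_one ℝ M hM.isSelfAdjoint, one_mulVec] at this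
  simpa using this

/-- A form of the Courant-Fischer min-max principle. -/
lemma Matrix.PosSemidef.map_eigenvalues₀_le {M N : Matrix ι ι ℂ} (hM : M.PosSemidef)
    (hN : N.IsHermitian) {g : ℝ → ℝ} (hg : MonotoneOn g (Set.Ici 0))
    (h : ∀ v : ι → ℂ, star v ⬝ᵥ v = 1 → g (star v ⬝ᵥ (M *ᵥ v)).re ≤ (star v ⬝ᵥ (N *ᵥ v)).re)
    (j : Fin (Fintype.card ι)) :
    g (hM.isHermitian.eigenvalues₀ j) ≤ hN.eigenvalues₀ j := by
  let e : Fin (Fintype.card ι) ≃ ι := Fintype.equivOfCardEq (Fintype.card_fin _)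
  -- There are (N-1-j) + j = N-1 < N conditions: v avoids the eigenvectors of M after j and those of
  -- N before j.
  obtain ⟨v, hv, hvM, hvN⟩ := exists_unit_mulVec_eq_zero
    (star (hM.isHermitian.eigenvectorUnitary : Matrix ι ι ℂ))
    (star (hN.eigenvectorUnitary : Matrix ι ι ℂ))
    ((Finset.Ioi j).map e.toEmbedding) ((Finset.Iio j).map e.toEmbedding)
    (by simp only [Finset.card_map, Fin.card_Ioi, Fin.card_Iio]; omega)
  have h1 := hM.isHermitian.dotProduct_self v
  have h2 := hN.dotProduct_self v
  rw [hv, eq_comm, Complex.ofReal_eq_one] at h1 h2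
  have h3 := h v hv
  rw [hM.isHermitian.dotProduct_mulVec_self, hN.dotProduct_mulVec_self, Complex.ofReal_re,
    Complex.ofReal_re] at h3
  refine (hg (hM.eigenvalues₀_nonneg j) ?_ ?_).trans (h3.trans ?_)
  · exact Finset.sum_nonneg fun i _ => mul_nonneg (by positivity) (hM.eigenvalues_nonneg i)
  · calc _ = ∑ i, ‖(star (hM.isHermitian.eigenvectorUnitary : Matrix ι ι ℂ) *ᵥ v) i‖ ^ 2 *
          hM.isHermitian.eigenvalues₀ j := by rw [← Finset.sum_mul, h1, one_mul]
      _ ≤ _ := Finset.sum_le_sum fun i _ => ?_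
    by_cases hi : j < e.symm i
    · rw [hvM i (by simpa [Equiv.eq_symm_apply] using hi)]; simp
    · exact mul_le_mul_of_nonneg_left
        (hM.isHermitian.eigenvalues₀_antitone (not_lt.1 hi)) (by positivity)
  · calc _ ≤ ∑ i, ‖(star (hN.eigenvectorUnitary : Matrix ι ι ℂ) *ᵥ v) i‖ ^ 2 *
          hN.eigenvalues₀ j := Finset.sum_le_sum fun i _ => ?_
      _ = _ := by rw [← Finset.sum_mul, h2, one_mul]
    by_cases hi : e.symm i < j
    · rw [hvN i (by simpa [Equiv.eq_symm_apply] using hi)]; simp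
    · exact mul_le_mul_of_nonneg_left (hN.eigenvalues₀_antitone (not_lt.1 hi)) (by positivity)

open Polynomial in
/-- Functional calculus preserves intertwining relations. -/
lemma Matrix.IsHermitian.cfc_mul_eq_mul_cfc {M N T : Matrix ι ι ℂ} (hM : M.IsHermitian)
    (hN : N.IsHermitian) (h : M * T = T * N) (f : ℝ → ℝ) : cfc f M * T = T * cfc f N := by
  -- A single polynomial agrees with f on both spectra, so the claim reduces to powers.
  let s : Finset ℝ := M.finite_real_spectrum.toFinset ∪ N.finite_real_spectrum.toFinset
  let q : ℝ[X] := Lagrange.interpolate s id f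
  have hq : ∀ x ∈ s, q.eval x = f x := fun x hx => by
    exact Lagrange.eval_interpolate_at_node (v := id) f (Set.injOn_id _) hx
  have key : ∀ r : ℝ[X], aeval M r * T = T * aeval N r := by
    intro r
    induction r using Polynomial.induction_on' with
    | add a b ha hb => simp [add_mul, mul_add, ha, hb]
    | monomial k a =>
      have hk : M ^ k * T = T * N ^ k := by
        induction k with
        | zero => simp
        | succ k ih => rw [pow_succ, mul_assoc, h, ← mul_assoc, ih, mul_assoc, ← pow_succ]
      rw [aeval_monomial, aeval_monomial, mul_assoc, hk, ← mul_assoc, ← mul_assoc,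
        Algebra.commutes a T]
  rw [cfc_congr (g := fun x => q.eval x) (a := M) fun x hx => (hq x (by simp [s, hx])).symm,
    cfc_congr (g := fun x => q.eval x) (a := N) fun x hx => (hq x (by simp [s, hx])).symm,
    cfc_polynomial q M hM.isSelfAdjoint, cfc_polynomial q N hN.isSelfAdjoint, key]

lemma Matrix.PosSemidef.rpow_mul_eq_mul_rpow {M N T : Matrix ι ι ℂ} (hM : M.PosSemidef)
    (hN : N.PosSemidef) (h : M * T = T * N) (t : ℝ) : M ^ t * T = T * N ^ t := by
  rw [CFC.rpow_eq_cfc_real hM.nonneg, CFC.rpow_eq_cfc_real hN.nonneg]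
  exact hM.isHermitian.cfc_mul_eq_mul_cfc hN.isHermitian h _

/-- T intertwines M with the zero matrix, and 0^t = 0 for t ≠ 0. -/
lemma Matrix.PosSemidef.rpow_mul_eq_zero {M T : Matrix ι ι ℂ} (hM : M.PosSemidef)
    (h : M * T = 0) {t : ℝ} (ht : t ≠ 0) : M ^ t * T = 0 := by
  rw [hM.rpow_mul_eq_mul_rpow PosSemidef.zero (by rw [h, mul_zero]) t,
    ← CFC.rpow_eq_pow, CFC.zero_rpow ht, mul_zero]

end SpectralTools

/-! ### Jensen's inequality for compressions and its equality case. -/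

section Compression

variable {ι : Type*} [Fintype ι]

/-- The missing mass is placed at 0, where f vanishes. Needed because ‖Ev‖ may be less than 1. -/
lemma ConvexOn.map_sum_le_of_sum_le_one {f : ℝ → ℝ} {s : Set ℝ} (hf : ConvexOn ℝ s f)
    (hs : 0 ∈ s) (h0 : f 0 = 0) {w x : ι → ℝ} (hw : ∀ i, 0 ≤ w i) (hw1 : ∑ i, w i ≤ 1)
    (hx : ∀ i, x i ∈ s) : f (∑ i, w i * x i) ≤ ∑ i, w i * f (x i) := by
  have := hf.map_add_sum_le (t := Finset.univ) (w := w) (p := x) (v := 1 - ∑ i, w i) (q := 0)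
    (fun i _ => hw i) (by ring) (fun i _ => hx i) (by linarith) hs
  simpa [h0] using this

lemma IsStarProjection.star_dotProduct_mulVec {E : Matrix ι ι ℂ} (hE : IsStarProjection E)
    (M : Matrix ι ι ℂ) (v : ι → ℂ) :
    star v ⬝ᵥ ((E * M * E) *ᵥ v) = star (E *ᵥ v) ⬝ᵥ (M *ᵥ (E *ᵥ v)) := by
  have hs : Eᴴ = E := hE.isSelfAdjoint
  rw [star_mulVec, hs, ← dotProduct_mulVec, mulVec_mulVec, mulVec_mulVec, mul_assoc]

lemma IsStarProjection.posSemidef_compression {E : Matrix ι ι ℂ} (hE : IsStarProjection E)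
    {M : Matrix ι ι ℂ} (hM : M.PosSemidef) : (E * M * E).PosSemidef := by
  have hs : Eᴴ = E := hE.isSelfAdjoint
  have := hM.mul_mul_conjTranspose_same E
  rwa [hs] at this

variable [DecidableEq ι]

lemma IsStarProjection.re_dotProduct_self_le {E : Matrix ι ι ℂ} (hE : IsStarProjection E)
    (v : ι → ℂ) : (star (E *ᵥ v) ⬝ᵥ (E *ᵥ v)).re ≤ (star v ⬝ᵥ v).re := by
  have h1 := hE.star_dotProduct_mulVec 1 v
  have h2 := hE.one_sub.star_dotProduct_mulVec 1 v
  rw [one_mulVec, mul_one, hE.isIdempotentElem.eq] at h1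
  rw [one_mulVec, mul_one, hE.one_sub.isIdempotentElem.eq, sub_mulVec, dotProduct_sub, h1,
    one_mulVec] at h2
  have h3 : 0 ≤ star ((v - E *ᵥ v)) ⬝ᵥ (v - E *ᵥ v) := dotProduct_star_self_nonneg _
  rw [← h2] at h3
  have := (Complex.nonneg_iff.1 h3).1
  rw [Complex.sub_re] at this
  linarith

/-- Jensen's inequality for the quadratic form of a compression. -/
lemma IsStarProjection.rpow_dotProduct_le {E C : Matrix ι ι ℂ} (hE : IsStarProjection E)
    (hC : C.PosSemidef) {p : ℝ} (hp : 1 ≤ p) {v : ι → ℂ} (hv : star v ⬝ᵥ v = 1) :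
    (star v ⬝ᵥ ((E * C * E) *ᵥ v)).re ^ p ≤ (star v ⬝ᵥ ((E * C ^ p * E) *ᵥ v)).re := by
  rw [hE.star_dotProduct_mulVec, hE.star_dotProduct_mulVec, CFC.rpow_eq_cfc_real hC.nonneg,
    hC.isHermitian.dotProduct_cfc_mulVec, hC.isHermitian.dotProduct_mulVec_self,
    Complex.ofReal_re, Complex.ofReal_re]
  refine (convexOn_rpow hp).map_sum_le_of_sum_le_one (f := fun x : ℝ => x ^ p) (by simp)
    (Real.zero_rpow (by positivity)) (fun i => by positivity) ?_ hC.eigenvalues_nonneg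
  have := hE.re_dotProduct_self_le v
  rwa [hv, hC.isHermitian.dotProduct_self, Complex.ofReal_re, Complex.one_re] at this

/-- Convexity of `x ↦ x ^ p`, eigenvalue by eigenvalue, under compressions. -/
lemma IsStarProjection.rpow_eigenvalues₀_le {E C : Matrix ι ι ℂ} (hE : IsStarProjection E)
    (hC : C.PosSemidef) {p : ℝ} (hp : 1 ≤ p) (i : Fin (Fintype.card ι)) :
    (hE.posSemidef_compression hC).isHermitian.eigenvalues₀ i ^ p ≤
      (hE.posSemidef_compression (C.posSemidef_rpow p)).isHermitian.eigenvalues₀ i :=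
  (hE.posSemidef_compression hC).map_eigenvalues₀_le _
    (Real.monotoneOn_rpow_Ici_of_exponent_nonneg (by positivity))
    (fun _ hv => hE.rpow_dotProduct_le hC hp hv) i

/-- The equality case of Jensen's inequality: a unit vector is an eigenvector. -/
lemma Matrix.PosSemidef.mulVec_eq_smul_of_rpow_eq {C : Matrix ι ι ℂ} (hC : C.PosSemidef)
    {p : ℝ} (hp : 1 < p) {v : ι → ℂ} (hv : star v ⬝ᵥ v = 1)
    (h : (star v ⬝ᵥ (C *ᵥ v)).re ^ p = (star v ⬝ᵥ (C ^ p *ᵥ v)).re) :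
    C *ᵥ v = (star v ⬝ᵥ (C *ᵥ v)) • v := by
  set U := (hC.isHermitian.eigenvectorUnitary : Matrix ι ι ℂ) with hU
  have hs := hC.isHermitian.dotProduct_self v
  rw [hv, eq_comm, Complex.ofReal_eq_one] at hs
  have hq := hC.isHermitian.dotProduct_mulVec_self v
  rw [CFC.rpow_eq_cfc_real hC.nonneg, hC.isHermitian.dotProduct_cfc_mulVec, hq,
    Complex.ofReal_re, Complex.ofReal_re] at h
  have hj := ((strictConvexOn_rpow hp).map_sum_eq_iff' (t := Finset.univ)
    (w := fun i => ‖(star U *ᵥ v) i‖ ^ 2) (p := hC.isHermitian.eigenvalues)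
    (fun i _ => by positivity) hs (fun i _ => hC.eigenvalues_nonneg i)).1
    (by simpa only [smul_eq_mul] using h)
  rw [hq]
  have hUU : U * star U = 1 := Unitary.coe_mul_star_self _
  have hsp : C = U * diagonal (fun i => (hC.isHermitian.eigenvalues i : ℂ)) * star U := by
    conv_lhs => rw [hC.isHermitian.spectral_theorem, Unitary.conjStarAlgAut_apply]
    rfl
  have hvU : v = U *ᵥ (star U *ᵥ v) := by rw [mulVec_mulVec, hUU, one_mulVec]
  nth_rewrite 1 [hsp]
  nth_rewrite 3 [hvU]
  rw [← mulVec_mulVec, ← mulVec_mulVec, ← mulVec_smul]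
  congr 1
  ext i
  rw [mulVec_diagonal, Pi.smul_apply, smul_eq_mul]
  by_cases hi : (star U *ᵥ v) i = 0
  · rw [hi]; simp
  · rw [hj i (Finset.mem_univ i) (by simpa using hi)]
    simp only [smul_eq_mul]
    rfl

/-- Comparing traces forces equality in Jensen at each eigenvector of ECE. This yields CE = ECE,
which is self-adjoint. -/
lemma IsStarProjection.mul_eq_mul_of_eigenvalues₀_eq {E C : Matrix ι ι ℂ}
    (hE : IsStarProjection E) (hC : C.PosDef) {p : ℝ} (hp : 1 < p)
    (h : ∀ i, (hE.posSemidef_compression hC.posSemidef).isHermitian.eigenvalues₀ i ^ p =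
      (hE.posSemidef_compression (C.posSemidef_rpow p)).isHermitian.eigenvalues₀ i) :
    E * C = C * E := by
  have hs : Eᴴ = E := hE.isSelfAdjoint
  have hEE : E * E = E := hE.isIdempotentElem
  set G := E * C * E with hGdef
  have hG : G.PosSemidef := hE.posSemidef_compression hC.posSemidef
  have hK : (E * C ^ p * E).PosSemidef := hE.posSemidef_compression (C.posSemidef_rpow p)
  let u : ι → ι → ℂ := fun i => ⇑(hG.isHermitian.eigenvectorBasis i)
  set U := (hG.isHermitian.eigenvectorUnitary : Matrix ι ι ℂ) with hU
  have hUU : U * star U = 1 := Unitary.coe_mul_star_self _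
  have hUU' : star U * U = 1 := Unitary.coe_star_mul_self _
  have hquad : ∀ (M : Matrix ι ι ℂ) i, star (u i) ⬝ᵥ (M *ᵥ u i) = (star U * M * U) i i := by
    intro M i
    rw [mul_assoc]
    rfl
  have hu : ∀ i, star (u i) ⬝ᵥ u i = 1 := fun i => by
    have := hquad 1 i
    rwa [one_mulVec, mul_one, hUU', one_apply_eq] at this
  have hGu : ∀ i, G *ᵥ u i = (hG.isHermitian.eigenvalues i : ℂ) • u i :=
    fun i => hG.isHermitian.mulVec_eigenvectorBasis i
  have hGq : ∀ i, star (u i) ⬝ᵥ (G *ᵥ u i) = hG.isHermitian.eigenvalues i := fun i => by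
    rw [hGu, dotProduct_smul, hu, smul_eq_mul, mul_one]
  have hle : ∀ i ∈ Finset.univ, hG.isHermitian.eigenvalues i ^ p ≤
      (star (u i) ⬝ᵥ ((E * C ^ p * E) *ᵥ u i)).re := fun i _ => by
    have := hE.rpow_dotProduct_le hC.posSemidef hp.le (hu i)
    rwa [← hGdef, hGq, Complex.ofReal_re] at this
  have hsum : ∑ i, hG.isHermitian.eigenvalues i ^ p =
      ∑ i, (star (u i) ⬝ᵥ ((E * C ^ p * E) *ᵥ u i)).re := by
    have ht := hK.isHermitian.trace_eq_sum_eigenvalues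
    have ht' : (star U * (E * C ^ p * E) * U).trace = (E * C ^ p * E).trace := by
      rw [trace_mul_comm, ← mul_assoc, hUU, one_mul]
    rw [← ht', Matrix.trace] at ht
    have ht2 := congrArg Complex.re ht
    simp only [Complex.re_sum, diag_apply, ← hquad, Complex.coe_algebraMap,
      Complex.ofReal_re] at ht2
    rw [ht2]
    exact Finset.sum_congr rfl fun i _ => h _
  have heq := (Finset.sum_eq_sum_iff_of_le hle).1 hsum
  have hkey : ∀ i, (C * E) *ᵥ u i = G *ᵥ u i := by
    intro i
    -- In the kernel of ECE, positivity of C gives CEu = 0; otherwise u lies in the range of E and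
    -- is an eigenvector of C.
    by_cases hi : hG.isHermitian.eigenvalues i = 0
    · have h0 : G *ᵥ u i = 0 := by rw [hGu, hi]; simp
      have h1 : star (E *ᵥ u i) ⬝ᵥ (C *ᵥ (E *ᵥ u i)) = 0 := by
        rw [← hE.star_dotProduct_mulVec, ← hGdef, h0, dotProduct_zero]
      rw [h0, ← mulVec_mulVec]
      exact (hC.posSemidef.dotProduct_mulVec_zero_iff _).1 h1
    · have hEu : E *ᵥ u i = u i := by
        have h1 : E *ᵥ (G *ᵥ u i) = G *ᵥ u i := by
          rw [mulVec_mulVec, hGdef, ← mul_assoc, ← mul_assoc, hEE]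
        rw [hGu, mulVec_smul] at h1
        exact smul_right_injective _ (Complex.ofReal_ne_zero.2 hi) h1
      have h2 : star (u i) ⬝ᵥ (C *ᵥ u i) = hG.isHermitian.eigenvalues i := by
        have := hE.star_dotProduct_mulVec C (u i)
        rw [hEu] at this
        rw [← this]
        exact hGq i
      have h3 := heq i (Finset.mem_univ i)
      rw [hE.star_dotProduct_mulVec, hEu] at h3
      rw [← mulVec_mulVec, hEu, hC.posSemidef.mulVec_eq_smul_of_rpow_eq hp (hu i)
        (by rw [h2, Complex.ofReal_re, h3]), h2, hGu]
  have hmul : C * E * U = G * U := by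
    ext a i
    exact congrFun (hkey i) a
  have hCE : C * E = G := by
    have := congrArg (· * star U) hmul
    simpa only [mul_assoc, hUU, mul_one] using this
  have := congrArg conjTranspose hCE
  rw [conjTranspose_mul, hs, hC.isHermitian.eq, hG.isHermitian.eq] at this
  rw [this, hCE]

end Compression

/-! ### Reduction of P and Q to compressions, and log-majorization. -/

section Renyi

variable {ι : Type*} [Fintype ι] [DecidableEq ι]

/-- If the partial products of a decreasing nonnegative sequence are dominated by those of a
pointwise smaller sequence, then both sequences agree. -/
lemma Antitone.eq_of_prod_le_of_le {m : ℕ} {a b : Fin m → ℝ} (ha : ∀ i, 0 ≤ a i)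
    (hb : Antitone b) (hab : ∀ i, a i ≤ b i)
    (h : ∀ k ≤ m, ∏ i with i.val < k, b i ≤ ∏ i with i.val < k, a i) : a = b := by
  funext j
  refine (hab j).antisymm (not_lt.1 fun hj => ?_)
  have hbj : 0 < b j := (ha j).trans_lt hj
  have hpos : ∀ i ∈ Finset.univ.filter (fun i : Fin m => i.val < j.val + 1), 0 < b i :=
    fun i hi => hbj.trans_le (hb (by
      have := (Finset.mem_filter.1 hi).2
      rw [Fin.le_def]; omega))
  have hjm : j ∈ Finset.univ.filter (fun i : Fin m => i.val < j.val + 1) := by simp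
  have hk := h (j.val + 1) j.isLt
  -- A zero factor would make the product of the a's vanish, yet it dominates a positive one.
  have ha' : ∀ i ∈ Finset.univ.filter (fun i : Fin m => i.val < j.val + 1), 0 < a i := by
    have hp := (Finset.prod_pos hpos).trans_le hk
    intro i hi
    refine (ha i).lt_of_ne fun h0 => hp.ne' (Finset.prod_eq_zero hi h0.symm)
  exact (Finset.prod_lt_prod ha' (fun i _ => hab i) ⟨j, hjm, hj⟩).not_ge hk

/-- E acts as 1 on its range and as 0 on the range of 1 - E. -/
lemma IsStarProjection.rpow_eq {E : Matrix ι ι ℂ} (hE : IsStarProjection E) {t : ℝ}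
    (ht : t ≠ 0) : E ^ t = E := by
  have hEE : E * E = E := hE.isIdempotentElem
  have hpos : E.PosSemidef := hE.nonneg.posSemidef
  have h1 := hpos.rpow_mul_eq_mul_rpow PosSemidef.one (T := E) (by rw [hEE, mul_one]) t
  have h2 := hpos.rpow_mul_eq_zero (T := 1 - E) (by rw [mul_sub, mul_one, hEE, sub_self]) ht
  rw [CFC.one_rpow, mul_one] at h1
  rwa [mul_sub, h1, mul_one, sub_eq_zero] at h2

lemma Matrix.PosSemidef.rpow_mul_self {M : Matrix ι ι ℂ} (hM : M.PosSemidef) {t : ℝ}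
    (ht : 0 < t) : M ^ t * M = M ^ (t + 1) := by
  rw [CFC.rpow_eq_cfc_real hM.nonneg, CFC.rpow_eq_cfc_real hM.nonneg]
  nth_rewrite 2 [← cfc_id ℝ M hM.isHermitian.isSelfAdjoint]
  rw [← cfc_mul (fun x : ℝ => x ^ t) id M (M.finite_real_spectrum.continuousOn _)
    (M.finite_real_spectrum.continuousOn _)]
  refine cfc_congr fun x hx => ?_
  have hx0 : 0 ≤ x := spectrum_nonneg_of_nonneg hM.nonneg hx
  simp only [id]
  rw [Real.rpow_add_one' hx0 (by positivity)]

lemma Matrix.PosDef.rpow_add {B : Matrix ι ι ℂ} (hB : B.PosDef) (s t : ℝ) :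
    B ^ s * B ^ t = B ^ (s + t) :=
  (CFC.rpow_add hB.isUnit).symm

lemma Matrix.PosDef.rpow_zero {B : Matrix ι ι ℂ} (hB : B.PosDef) : B ^ (0 : ℝ) = 1 :=
  CFC.rpow_zero B hB.posSemidef.nonneg

lemma Matrix.PosDef.rpow {B : Matrix ι ι ℂ} (hB : B.PosDef) (t : ℝ) : (B ^ t).PosDef := by
  have hu : IsUnit (B ^ t) := by
    refine ⟨⟨B ^ t, B ^ (-t), ?_, ?_⟩, rfl⟩ <;> rw [hB.rpow_add] <;> simp [hB.rpow_zero]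
  exact (B.posSemidef_rpow t).posDef_iff_isUnit.2 hu

lemma Matrix.PosDef.rpow_rpow {B : Matrix ι ι ℂ} (hB : B.PosDef) (s : ℝ) {t : ℝ} (hs : s ≠ 0) :
    (B ^ s) ^ t = B ^ (s * t) :=
  CFC.rpow_rpow B s t hs hB.isStrictlyPositive

variable {n : ℕ}

/-- For a projection `E`, the matrix `P_α(E, B)` is a power of the compression of `B⁻¹`. -/
lemma renyiP_eq_rpow {α : ℝ} (hα : 1 < α) {E B : Matrix (Fin n) (Fin n) ℂ}
    (hE : IsStarProjection E) (hB : B.PosDef) :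
    renyiP α E B = (E * B ^ (-1 : ℝ) * E) ^ (α - 1) := by
  have hEE : E * E = E := hE.isIdempotentElem
  have hG : (E * B ^ (-1 : ℝ) * E).PosSemidef :=
    hE.posSemidef_compression (B.posSemidef_rpow _)
  have hS : (B ^ (-(1 / 2) : ℝ) * E * B ^ (-(1 / 2) : ℝ)).PosSemidef := by
    have := (hE.nonneg.posSemidef).mul_mul_conjTranspose_same (B ^ (-(1 / 2) : ℝ))
    rwa [(hB.rpow _).isHermitian.eq] at this
  unfold renyiP
  set S := B ^ (-(1 / 2) : ℝ) * E * B ^ (-(1 / 2) : ℝ) with hSdef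
  set G := E * B ^ (-1 : ℝ) * E with hGdef
  have hhalf : B ^ (-(1 / 2) : ℝ) * B ^ (-(1 / 2) : ℝ) = B ^ (-1 : ℝ) := by
    rw [hB.rpow_add]; norm_num
  have hinv : B ^ (1 / 2 : ℝ) * B ^ (-(1 / 2) : ℝ) = 1 := by
    rw [hB.rpow_add]; norm_num [hB.rpow_zero]
  have hinv' : B ^ (-(1 / 2) : ℝ) * B ^ (1 / 2 : ℝ) = 1 := by
    rw [hB.rpow_add]; norm_num [hB.rpow_zero]
  -- T = B^(-1/2) E satisfies S = T T* and G = T* T, so it carries powers of G to powers of S.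
  have hT : S * (B ^ (-(1 / 2) : ℝ) * E) = (B ^ (-(1 / 2) : ℝ) * E) * G := by
    rw [hSdef, hGdef, ← hhalf]
    simp only [← mul_assoc]
    simp only [mul_assoc _ E E, hEE]
  have hpow := hS.rpow_mul_eq_mul_rpow hG hT (α - 1)
  have hsplit : S ^ α = S ^ (α - 1) * S := by
    rw [hS.rpow_mul_self (by linarith), sub_add_cancel]
  have hGE : G ^ (α - 1) * E = G ^ (α - 1) := by
    have := hG.rpow_mul_eq_zero (T := 1 - E) (t := α - 1)
      (by rw [mul_sub, mul_one, hGdef, mul_assoc _ E E, hEE, sub_self]) (by linarith)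
    rwa [mul_sub, mul_one, sub_eq_zero, eq_comm] at this
  have hEG : E * G ^ (α - 1) = G ^ (α - 1) := by
    have := congrArg conjTranspose hGE
    rwa [conjTranspose_mul, (G.posSemidef_rpow _).isHermitian.eq,
      show Eᴴ = E from hE.isSelfAdjoint] at this
  calc B ^ (1 / 2 : ℝ) * S ^ α * B ^ (1 / 2 : ℝ)
      = B ^ (1 / 2 : ℝ) * (S ^ (α - 1) * (B ^ (-(1 / 2) : ℝ) * E)) *
          (B ^ (-(1 / 2) : ℝ) * B ^ (1 / 2 : ℝ)) := by
        rw [hsplit, hSdef]; simp only [mul_assoc]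
    _ = (B ^ (1 / 2 : ℝ) * B ^ (-(1 / 2) : ℝ)) * (E * G ^ (α - 1)) := by
        rw [hpow, hinv', mul_one]; simp only [mul_assoc]
    _ = _ := by rw [hinv, one_mul, hEG]

lemma Matrix.PosDef.commute_of_rpow {E B : Matrix ι ι ℂ} (hB : B.PosDef) {t : ℝ} (ht : t ≠ 0)
    (h : E * B ^ t = B ^ t * E) : E * B = B * E := by
  have := (hB.rpow t).posSemidef.rpow_mul_eq_mul_rpow (hB.rpow t).posSemidef h.symm t⁻¹
  rw [hB.rpow_rpow t ht, mul_inv_cancel₀ ht, CFC.rpow_one B hB.posSemidef.nonneg] at this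
  exact this.symm

/-- With D = B^((1-α)/(2z)), DED = (DE)(ED) and (ED)(DE) = E D² E share a characteristic polynomial.
-/
lemma renyiQ_eigenvalues₀ {α z : ℝ} (hα : 0 < α) (hz : 0 < z) {E B : Matrix (Fin n) (Fin n) ℂ}
    (hE : IsStarProjection E) (hB : B.PosDef) :
    ∃ hQ : (renyiQ α z E B).PosSemidef, ∀ i, hQ.isHermitian.eigenvalues₀ i =
      (hE.posSemidef_compression
        (B.posSemidef_rpow (-((α - 1) / z)))).isHermitian.eigenvalues₀ i ^ z := by
  have hEE : E * E = E := hE.isIdempotentElem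
  have hS : (B ^ ((1 - α) / (2 * z)) * E * B ^ ((1 - α) / (2 * z))).PosSemidef := by
    have := (hE.nonneg.posSemidef).mul_mul_conjTranspose_same (B ^ ((1 - α) / (2 * z)))
    rwa [(hB.rpow _).isHermitian.eq] at this
  unfold renyiQ
  rw [hE.rpow_eq (div_pos hα hz).ne']
  refine ⟨posSemidef_rpow _ _, fun i => ?_⟩
  rw [hS.eigenvalues₀_rpow hz.le]
  congr 1
  refine congrFun (hS.isHermitian.eigenvalues₀_congr _ ?_) i
  have hexp : B ^ (-((α - 1) / z)) = B ^ ((1 - α) / (2 * z)) * B ^ ((1 - α) / (2 * z)) := by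
    rw [hB.rpow_add]
    congr 1
    field_simp
    ring
  generalize B ^ ((1 - α) / (2 * z)) = D at hexp
  rw [hexp]
  calc (D * E * D).charpoly = ((D * E) * (E * D)).charpoly := by
        rw [← mul_assoc, mul_assoc D E E, hEE]
    _ = ((E * D) * (D * E)).charpoly := charpoly_mul_comm _ _
    _ = _ := by simp only [mul_assoc]

lemma Matrix.IsHermitian.prod_eigenvalues₀_eq_zero {M : Matrix ι ι ℂ} (hM : M.IsHermitian)
    (h : M.det = 0) : ∏ i, hM.eigenvalues₀ i = 0 := by
  rw [hM.det_eq_prod_eigenvalues] at h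
  have h' : ∏ i, hM.eigenvalues i = 0 :=
    Complex.ofReal_eq_zero.1 (by rw [Complex.ofReal_prod]; exact h)
  rw [← h']
  exact (Equiv.prod_comp (Fintype.equivOfCardEq (Fintype.card_fin _)).symm hM.eigenvalues₀).symm

/-- Compressions by a projection `E` decrease powers with exponent `q ≥ 1` in log-majorization,
strictly so if `q > 1` and `E` does not commute with the matrix. -/
lemma logMajorized_of_compression {E C D X Y : Matrix (Fin n) (Fin n) ℂ}
    (hE : IsStarProjection E) (hC : C.PosDef) (hEC : E * C ≠ C * E) {q s : ℝ} (hq : 1 ≤ q)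
    (hs : 0 < s) (hD : C ^ q = D) (hDp : D.PosSemidef) (hX : X.PosSemidef) (hY : Y.PosSemidef)
    (hXe : ∀ i, hX.isHermitian.eigenvalues₀ i =
      (hE.posSemidef_compression hC.posSemidef).isHermitian.eigenvalues₀ i ^ (q * s))
    (hYe : ∀ i, hY.isHermitian.eigenvalues₀ i =
      (hE.posSemidef_compression hDp).isHermitian.eigenvalues₀ i ^ s) :
    LogMajorized X Y ∧ (1 < q → ¬ LogMajorized Y X) := by
  subst hD
  have hCE := hE.posSemidef_compression hC.posSemidef
  have hDE := hE.posSemidef_compression hDp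
  have hq0 : 0 < q := by linarith
  have hle : ∀ i, hX.isHermitian.eigenvalues₀ i ≤ hY.isHermitian.eigenvalues₀ i := fun i => by
    rw [hXe, hYe, Real.rpow_mul (hCE.eigenvalues₀_nonneg i)]
    exact Real.rpow_le_rpow (Real.rpow_nonneg (hCE.eigenvalues₀_nonneg i) _)
      (hE.rpow_eigenvalues₀_le hC.posSemidef hq i) hs.le
  refine ⟨⟨hX, hY, fun k _ => Finset.prod_le_prod (fun i _ => hX.eigenvalues₀_nonneg i)
    fun i _ => hle i, ?_⟩, ?_⟩
  -- An invertible idempotent is 1, which would commute with C.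
  · have hdet : E.det = 0 := by
      by_contra h
      have hu : IsUnit E := (isUnit_iff_isUnit_det E).2 (isUnit_iff_ne_zero.2 h)
      have h1 : E = 1 := hu.mul_left_cancel (by rw [hE.isIdempotentElem.eq, mul_one])
      exact hEC (by rw [h1, one_mul, mul_one])
    have h1 := hCE.isHermitian.prod_eigenvalues₀_eq_zero (by simp [hdet])
    have h2 := hDE.isHermitian.prod_eigenvalues₀_eq_zero (by simp [hdet])
    simp_rw [hXe, hYe]
    rw [Real.finsetProd_rpow _ _ fun i _ => hCE.eigenvalues₀_nonneg i,
      Real.finsetProd_rpow _ _ fun i _ => hDE.eigenvalues₀_nonneg i, h1, h2,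
      Real.zero_rpow (mul_pos hq0 hs).ne', Real.zero_rpow hs.ne']
  · rintro hq1 ⟨hY', hX', h, -⟩
    have heq := hY.isHermitian.eigenvalues₀_antitone.eq_of_prod_le_of_le
      hX.eigenvalues₀_nonneg hle (fun k hk => h k (by simpa using hk))
    refine hEC (hE.mul_eq_mul_of_eigenvalues₀_eq hC hq1 fun i => ?_)
    have hi := congrFun heq i
    rw [hXe, hYe, Real.rpow_mul (hCE.eigenvalues₀_nonneg i)] at hi
    exact Real.rpow_left_injOn hs.ne' (Real.rpow_nonneg (hCE.eigenvalues₀_nonneg i) _)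
      (hDE.eigenvalues₀_nonneg i) hi

end Renyi

theorem proposition2p3 {n : ℕ} (α z : ℝ) (hα : 1 < α) (hz : 0 < z)
    (E B : Matrix (Fin n) (Fin n) ℂ) (hE : IsStarProjection E) (hB : B.PosDef)
    (hEB : E * B ≠ B * E) :
    (LogMajorized (renyiP α E B) (renyiQ α z E B) ↔ z ≤ α - 1) ∧
      (LogMajorized (renyiQ α z E B) (renyiP α E B) ↔ α - 1 ≤ z) := by
  have hα0 : 0 < α - 1 := by linarith
  set p := (α - 1) / z with hp
  have hp0 : 0 < p := div_pos hα0 hz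
  have hpz : p * z = α - 1 := div_mul_cancel₀ _ hz.ne'
  have hpi : p⁻¹ * (α - 1) = z := by rw [← hpz, inv_mul_cancel_left₀ hp0.ne']
  obtain ⟨hQ, hQe⟩ := renyiQ_eigenvalues₀ (zero_lt_one.trans hα) hz hE hB
  have hG := hE.posSemidef_compression (B.posSemidef_rpow (-1))
  obtain ⟨hP, hPe⟩ : ∃ hP : (renyiP α E B).PosSemidef, ∀ i, hP.isHermitian.eigenvalues₀ i =
      hG.isHermitian.eigenvalues₀ i ^ (α - 1) := by
    rw [renyiP_eq_rpow hα hE hB]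
    exact ⟨posSemidef_rpow _ _, hG.eigenvalues₀_rpow hα0.le⟩
  have hge : z ≤ α - 1 → LogMajorized (renyiP α E B) (renyiQ α z E B) ∧
      (1 < p → ¬ LogMajorized (renyiQ α z E B) (renyiP α E B)) := fun h =>
    logMajorized_of_compression (D := B ^ (-p)) hE (hB.rpow (-1))
      (fun hc => hEB (hB.commute_of_rpow (by norm_num) hc)) ((one_le_div hz).2 h) hz
      (by rw [hB.rpow_rpow _ (by norm_num), neg_one_mul]) (posSemidef_rpow _ _) hP hQ
      (fun i => by rw [hpz]; exact hPe i) hQe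
  have hle : α - 1 ≤ z → LogMajorized (renyiQ α z E B) (renyiP α E B) ∧
      (1 < p⁻¹ → ¬ LogMajorized (renyiP α E B) (renyiQ α z E B)) := fun h =>
    -- The roles swap: the base is B^(-p), and the exponent 1/p brings it back to B⁻¹.
    logMajorized_of_compression (D := B ^ (-1 : ℝ)) hE (hB.rpow (-p))
      (fun hc => hEB (hB.commute_of_rpow (neg_ne_zero.2 hp0.ne') hc))
      ((one_le_inv₀ hp0).2 ((div_le_one hz).2 h)) hα0
      (by rw [hB.rpow_rpow _ (neg_ne_zero.2 hp0.ne'), neg_mul, mul_inv_cancel₀ hp0.ne'])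
      (posSemidef_rpow _ _) hQ hP (fun i => by rw [hpi]; exact hQe i) hPe
  refine ⟨⟨fun h => ?_, fun h => (hge h).1⟩, ⟨fun h => ?_, fun h => (hle h).1⟩⟩
  · by_contra! hlt
    exact (hle hlt.le).2 ((one_lt_inv₀ hp0).2 ((div_lt_one hz).2 hlt)) h
  · by_contra! hlt
    exact (hge hlt.le).2 ((one_lt_div hz).2 hlt) h
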